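/- A group is called $2$-generated if it is generated by at most two of its elements. The generating graph of a group $G$ is the simple graph whose vertices are the elements of $G$ and in which two distinct elements $x, y$ are adjacent if and only if $\langle x, y\rangle = G$. A finite group $H$ is supersoluble if it has a series $1 = N_0 \le N_1 \le \dots \le N_n = H$ in which each $N_i$ is normal in $H$ and each factor $N_{i+1}/N_i$ is cyclic. **Theorem.** Let $G$ and $H$ be finite $2$-generated groups whose generating graphs are isomorphic. If $G$ is nilpotent and $H$ is supersoluble, then $H$ is nilpotent. -/

import Mathlib

/-- A group is `2`-generated if it is generated by some two (possibly equal) elements, that is,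
by at most two elements. -/
def IsTwoGenerated (G : Type*) [Group G] : Prop :=
  ∃ x y : G, Subgroup.closure {x, y} = ⊤

/-- The generating graph of a group `G`: the vertices are all the elements of `G`, and two distinct
elements are adjacent if and only if together they generate `G`. -/
def generatingGraph (G : Type*) [Group G] : SimpleGraph G where
  Adj x y := x ≠ y ∧ Subgroup.closure {x, y} = ⊤
  symm := ⟨fun x y h => ⟨h.1.symm, by rw [Set.pair_comm]; exact h.2⟩⟩
  loopless := ⟨fun _ h => h.1 rfl⟩

/-- A group `G` is supersoluble if it has a finite series `1 = N 0 ≤ N 1 ≤ ⋯ ≤ N n = G` in which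
every term is normal in the whole group `G` and every factor `N (i + 1) / N i` is cyclic. (The
values `N i` with `i > n` play no role.) -/
def IsSupersoluble (G : Type*) [Group G] : Prop :=
  ∃ (n : ℕ) (N : ℕ → Subgroup G) (_ : ∀ i, (N i).Normal),
    N 0 = ⊥ ∧ N n = ⊤ ∧
      ∀ i < n, N i ≤ N (i + 1) ∧ IsCyclic (N (i + 1) ⧸ (N i).subgroupOf (N (i + 1)))

/-!
For an element `x` of a finite group and a prime `p`, let `f_p(x)` be the number of subgroups of
index `p` containing `x`. The proof rests on the fact that the generating graph of a supersoluble
group determines `f_p(x)` for every `x` lying in a generating pair.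

Indeed, let `A` be a normal subgroup of prime order. If `x` and `y` generate the group modulo `A`,
the lifts of `y` that fail to generate together with `x` correspond to the complements of `A`
containing `x`, and there is at most one such complement if `x` lies in a generating pair
(`Subgroup.complementsThrough_subsingleton`). By induction along a chief series the number of
partners of `x` is `|G| ∏_p (1 - 1/p) ^ f_p(x)` (`HasPrimeSeries.genCount_eq`). Since the numbers
`1 - 1/p` are multiplicatively independent (`eq_of_prod_one_sub_inv_prime_pow_eq`), an isomorphism
of generating graphs of noncyclic groups preserves all `f_p` (`ncard_indexThrough_eq_of_iso`).
Cyclic groups are recognized by a vertex adjacent to all others.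

In a nilpotent group subgroups of index `p` are normal, hence kernels of homomorphisms to `ZMod p`.
Linear algebra then gives, with `x`, `y`, `z` ranging over members of generating pairs, that
`f_p(x) ≤ 1`, and that if `f_p(x) = f_p(y) = 1` for one generating pair `x, y`, then `f_p(z) = 1`
for all `z`. Both properties pass to `H`, and they force its subgroups of index `p` to be normal
(`HasPrimeSeries.normal_of_index_eq_prime`). Otherwise a nonnormal `M` of index `p` complements a
noncentral chief factor, on which the group acts through a homomorphism `k` to the cyclic group
`(ZMod p)ˣ`. There is a generating pair with `k x = 1 ≠ k y`; as elements with `k ≠ 1` lie in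
conjugates of `M`, the pair `x * y, y` shows that `f_p = 1` on all generating pairs. The subgroups
of index `p` through `x` and through `x * y ^ (p - 1)` turn out to be normal and distinct, so that `y`
lies in a normal subgroup of index `p` as well as in a conjugate of `M`, contradicting `f_p(y) ≤ 1`.

Finally, maximal subgroups of a supersoluble group have prime index, and a finite group all of whose
maximal subgroups are normal is nilpotent.
-/

/-! ### Normal subgroups of prime order and their complements -/

section PrimeNormal

variable {G : Type*} [Group G]

theorem Subgroup.sup_eq_top_of_index_prime {A L : Subgroup G} (hL : L.index.Prime)
    (hAL : ¬ A ≤ L) : A ⊔ L = ⊤ := by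
  have hle : L ≤ A ⊔ L := le_sup_right
  rcases (Nat.dvd_prime hL).1 (Subgroup.index_dvd_of_le hle) with h | h
  · exact Subgroup.index_eq_one.1 h
  · exfalso
    have h1 := Subgroup.relIndex_mul_index hle
    rw [h] at h1
    have h2 : L.relIndex (A ⊔ L) = 1 := Nat.eq_of_mul_eq_mul_right hL.pos (by rw [h1, one_mul])
    exact hAL (le_sup_left.trans (Subgroup.relIndex_eq_one.1 h2))

theorem Subgroup.isComplement'_of_sup_eq_top {A L : Subgroup G} [A.Normal]
    (hA : (Nat.card A).Prime) (hAL : A ⊔ L = ⊤) (hL : L ≠ ⊤) : A.IsComplement' L := by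
  have := Fact.mk hA
  have : Finite A := Nat.finite_of_card_ne_zero hA.ne_zero
  refine Subgroup.isComplement'_of_disjoint_and_mul_eq_univ ?_ ?_
  · rcases (L.subgroupOf A).eq_bot_or_eq_top_of_prime_card with h | h
    · exact (Subgroup.subgroupOf_eq_bot.1 h).symm
    · refine absurd ?_ hL
      rwa [sup_eq_right.2 (Subgroup.subgroupOf_eq_top.1 h)] at hAL
  · rw [← Subgroup.normal_mul, hAL, Subgroup.coe_top]

theorem Subgroup.index_eq_card_of_sup_eq_top {A L : Subgroup G} [A.Normal]
    (hA : (Nat.card A).Prime) (hAL : A ⊔ L = ⊤) (hL : L ≠ ⊤) : L.index = Nat.card A :=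
  (isComplement'_of_sup_eq_top hA hAL hL).index_eq_card

theorem Subgroup.eq_of_le_of_index_eq [Finite G] {K L : Subgroup G} (h : K ≤ L)
    (hi : K.index = L.index) : K = L := by
  by_contra hne
  exact absurd hi (Subgroup.index_strictAnti (lt_of_le_of_ne h hne)).ne'

theorem Subgroup.comap_map_mk' {A M : Subgroup G} [A.Normal] (h : A ≤ M) :
    (M.map (QuotientGroup.mk' A)).comap (QuotientGroup.mk' A) = M := by
  rw [Subgroup.comap_map_eq, QuotientGroup.ker_mk', sup_eq_left.2 h]

theorem Subgroup.index_map_mk' {A M : Subgroup G} [A.Normal] (h : A ≤ M) :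
    (M.map (QuotientGroup.mk' A)).index = M.index :=
  M.index_map_eq (QuotientGroup.mk'_surjective A) (by rwa [QuotientGroup.ker_mk'])

theorem Subgroup.sup_closure_pair_eq_top {A : Subgroup G} [A.Normal] {x y : G}
    (h : Subgroup.closure {(x : G ⧸ A), (y : G ⧸ A)} = ⊤) :
    A ⊔ Subgroup.closure {x, y} = ⊤ := by
  have h1 : (Subgroup.closure {x, y}).map (QuotientGroup.mk' A) = ⊤ := by
    rw [MonoidHom.map_closure, Set.image_pair]; exact h
  have h2 := congrArg (Subgroup.comap (QuotientGroup.mk' A)) h1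
  rwa [Subgroup.comap_map_eq, QuotientGroup.ker_mk', Subgroup.comap_top, sup_comm] at h2

theorem Subgroup.closure_pair_map_eq_top {Q : Type*} [Group Q] {f : G →* Q}
    (hf : Function.Surjective f) {x y : G} (h : Subgroup.closure {x, y} = ⊤) :
    Subgroup.closure {f x, f y} = ⊤ := by
  have := congrArg (Subgroup.map f) h
  rwa [MonoidHom.map_closure, Set.image_pair, Subgroup.map_top_of_surjective f hf] at this

theorem Subgroup.closure_pair_le {L : Subgroup G} {x y : G} (hx : x ∈ L) (hy : y ∈ L) :
    Subgroup.closure {x, y} ≤ L := by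
  rw [Subgroup.closure_le]
  rintro z (rfl | rfl) <;> assumption

/-- Raising the `A`-component to the `j`-th power is an endomorphism of `G = A ⋊ L` when `A` is
commutative. -/
theorem Subgroup.IsComplement'.exists_pow_endomorphism {A L : Subgroup G} [A.Normal]
    (h : A.IsComplement' L) (hcomm : ∀ a b : A, a * b = b * a) (j : ℕ) :
    ∃ e : G →* G, (∀ l ∈ L, e l = l) ∧ ∀ a ∈ A, e a = a ^ j := by
  let E := SemidirectProduct.mulEquivSubgroup h
  let pw : A →* A :=
    { toFun := fun a => a ^ j
      map_one' := one_pow j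
      map_mul' := fun a b => (show Commute a b from hcomm a b).mul_pow j }
  let e := (SemidirectProduct.lift (A.subtype.comp pw) L.subtype
    (by intro g; ext a; simp [pw])).comp E.symm.toMonoidHom
  have hEl : ∀ l : L, E.symm l = SemidirectProduct.inr l := fun l => by
    rw [MulEquiv.symm_apply_eq]; simp [E]
  have hEa : ∀ a : A, E.symm a = SemidirectProduct.inl a := fun a => by
    rw [MulEquiv.symm_apply_eq]; simp [E]
  refine ⟨e, fun l hl => ?_, fun a ha => ?_⟩
  · have := hEl ⟨l, hl⟩
    simp [e, this]
  · have := hEa ⟨a, ha⟩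
    simp [e, this, pw]

theorem Subgroup.closure_pair_eq_of_le {A L : Subgroup G} [Finite G] [A.Normal]
    (hA : (Nat.card A).Prime) {x y : G} (hxy : A ⊔ Subgroup.closure {x, y} = ⊤)
    (hL : L.index = Nat.card A) (hx : x ∈ L) (hy : y ∈ L) : Subgroup.closure {x, y} = L := by
  have hle := Subgroup.closure_pair_le hx hy
  have hLt : L ≠ ⊤ := fun h => hA.ne_one (by rw [← hL, h, Subgroup.index_top])
  have hne : Subgroup.closure {x, y} ≠ ⊤ := fun h => hLt (top_le_iff.1 (h ▸ hle))
  exact Subgroup.eq_of_le_of_index_eq hle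
    ((Subgroup.index_eq_card_of_sup_eq_top hA hxy hne).trans hL.symm)

/-- The complements containing `x` of a normal subgroup `A` of prime order. A subgroup is such a
complement if and only if its index is the order of `A` and it does not contain `A`. -/
def Subgroup.complementsThrough (A : Subgroup G) (x : G) : Set (Subgroup G) :=
  {L | L.index = Nat.card A ∧ x ∈ L ∧ ¬ A ≤ L}

/-- If two complements `⟨x, y₁⟩` and `⟨x, y₁ * a⟩` of `A` contain `x`, then all the subgroups
`⟨x, y₁ * a ^ j⟩` are images of the second one under endomorphisms of `G`, hence proper; so `x` does
not belong to a generating pair. -/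
theorem Subgroup.complementsThrough_subsingleton [Finite G] {A : Subgroup G} [A.Normal]
    (hA : (Nat.card A).Prime) {x y : G} (hxy : Subgroup.closure {x, y} = ⊤) :
    (A.complementsThrough x).Subsingleton := by
  rintro L ⟨hL, hxL, hAL⟩ L' ⟨hL', hxL', hAL'⟩
  by_contra hne
  have := Fact.mk hA
  have hAL := Subgroup.sup_eq_top_of_index_prime (hL ▸ hA) hAL
  have hAL' := Subgroup.sup_eq_top_of_index_prime (hL' ▸ hA) hAL'
  have hLt : L ≠ ⊤ := fun h => hA.ne_one (by rw [← hL, h, Subgroup.index_top])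
  have hLt' : L' ≠ ⊤ := fun h => hA.ne_one (by rw [← hL', h, Subgroup.index_top])
  -- a complement of `A` meets the coset `y * A`
  have key : ∀ K : Subgroup G, A ⊔ K = ⊤ → ∃ k ∈ K, k⁻¹ * y ∈ A := by
    intro K hK
    have : y ∈ K ⊔ A := by rw [sup_comm, hK]; trivial
    rw [← SetLike.mem_coe, Subgroup.mul_normal] at this
    obtain ⟨k, hk, a, ha, rfl⟩ := this
    exact ⟨k, hk, by simpa using ha⟩
  obtain ⟨y₁, hy₁, hb⟩ := key L hAL
  obtain ⟨y₂, hy₂, hc⟩ := key L' hAL'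
  have ha : y₁⁻¹ * y₂ ∈ A := by
    have := A.mul_mem hb (A.inv_mem hc)
    simpa [mul_assoc] using this
  have hsup : A ⊔ Subgroup.closure {x, y₁} = ⊤ := by
    apply Subgroup.sup_closure_pair_eq_top
    have h1 := Subgroup.closure_pair_map_eq_top (QuotientGroup.mk'_surjective A) hxy
    have h2 : (QuotientGroup.mk' A y : G ⧸ A) = y₁ := (QuotientGroup.eq.2 hb).symm
    rw [h2] at h1; exact h1
  have ha1 : y₁⁻¹ * y₂ ≠ 1 := by
    intro h
    have h12 : y₁ = y₂ := by rwa [inv_mul_eq_one] at h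
    have e1 := Subgroup.closure_pair_eq_of_le hA hsup hL hxL hy₁
    have e2 := Subgroup.closure_pair_eq_of_le hA hsup hL' hxL' (h12 ▸ hy₂)
    exact hne (e1.symm.trans e2)
  have hcyc : IsCyclic A := isCyclic_of_prime_card rfl
  have hbz : (⟨y₁⁻¹ * y, hb⟩ : A) ∈ Submonoid.powers (⟨y₁⁻¹ * y₂, ha⟩ : A) :=
    mem_powers_of_prime_card rfl (by simpa [Subtype.ext_iff] using ha1)
  obtain ⟨j, hj⟩ := hbz
  -- the endomorphism fixing `L` and raising `A` to the `j`-th power maps `y₂` to `y`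
  obtain ⟨e, he, hea⟩ := (Subgroup.isComplement'_of_sup_eq_top hA hAL
    hLt).exists_pow_endomorphism (fun a b => hcyc.isMulCommutative.is_comm.comm a b) j
  have hy : e y₂ = y := by
    have h1 : y₂ = y₁ * (y₁⁻¹ * y₂) := by group
    rw [h1, map_mul, he _ hy₁, hea _ ha]
    have := congrArg Subtype.val hj
    simp only [SubmonoidClass.mk_pow] at this
    rw [this]; group
  have htop : L'.map e = ⊤ := by
    rw [← top_le_iff, ← hxy]
    exact Subgroup.closure_pair_le ⟨x, hxL', he x hxL⟩ ⟨y₂, hy₂, hy⟩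
  have hcard : Nat.card G ≤ Nat.card L' := by
    rw [← Subgroup.card_top (G := G), ← htop]
    exact Nat.card_le_card_of_surjective _ (e.subgroupMap_surjective L')
  exact hLt' (Subgroup.eq_top_of_le_card _ hcard)

end PrimeNormal

/-! ### Counting the partners of an element in generating pairs -/

section Degree

/-- The number of elements that generate `G` together with `x`; it counts `x` itself if `x`
generates `G`. -/
noncomputable def genCount {G : Type*} [Group G] (x : G) : ℕ :=
  Nat.card {y : G // Subgroup.closure {x, y} = ⊤}

/-- The subgroups of index `p` containing `x`. -/
def indexThrough {G : Type*} [Group G] (p : ℕ) (x : G) : Set (Subgroup G) :=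
  {M | M.index = p ∧ x ∈ M}

theorem ncard_coset {G : Type*} [Group G] {A : Subgroup G} (y : G) :
    {z : G | (z : G ⧸ A) = y}.ncard = Nat.card A := by
  have : {z : G | (z : G ⧸ A) = y} = (y * ·) '' (A : Set G) := by
    ext z
    constructor
    · intro h
      exact ⟨y⁻¹ * z, QuotientGroup.eq.1 (Eq.symm h), by simp⟩
    · rintro ⟨a, ha, rfl⟩
      exact (QuotientGroup.eq.2 (by simpa using ha)).symm
  rw [this, Set.ncard_image_of_injective _ (mul_right_injective y)]
  exact (Nat.card_coe_set_eq _).symm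

variable {G : Type*} [Group G] [Finite G] {A : Subgroup G} [A.Normal]

/-- The lifts of `y` modulo `A` that fail to generate `G` together with `x` correspond to the
complements of `A` containing `x`. -/
theorem ncard_lifts_not_generating (hA : (Nat.card A).Prime) {x y : G}
    (hxy : Subgroup.closure {(x : G ⧸ A), (y : G ⧸ A)} = ⊤) :
    {z : G | (z : G ⧸ A) = y ∧ Subgroup.closure {x, z} ≠ ⊤}.ncard =
      (A.complementsThrough x).ncard := by
  have hsup : ∀ z : G, (z : G ⧸ A) = y → A ⊔ Subgroup.closure {x, z} = ⊤ := fun z hz =>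
    Subgroup.sup_closure_pair_eq_top (hz ▸ hxy)
  refine Set.ncard_congr (fun z _ => Subgroup.closure {x, z}) ?_ ?_ ?_
  · rintro z ⟨hz, hne⟩
    refine ⟨Subgroup.index_eq_card_of_sup_eq_top hA (hsup z hz) hne,
      Subgroup.subset_closure (by simp), fun hle => hne ?_⟩
    rw [← hsup z hz, sup_eq_right.2 hle]
  · rintro z w ⟨hz, hne⟩ ⟨hw, -⟩ heq
    have hdis := (Subgroup.isComplement'_of_sup_eq_top hA (hsup z hz) hne).disjoint
    have h1 : z⁻¹ * w ∈ A := QuotientGroup.eq.1 (hz.trans hw.symm)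
    have hzm : z ∈ Subgroup.closure {x, z} := Subgroup.subset_closure (by simp)
    have hwm : w ∈ Subgroup.closure {x, z} := by
      rw [show Subgroup.closure {x, z} = Subgroup.closure {x, w} from heq]
      exact Subgroup.subset_closure (by simp)
    exact inv_mul_eq_one.1 (Subgroup.disjoint_def.1 hdis h1 (mul_mem (inv_mem hzm) hwm))
  · rintro L ⟨hL, hxL, hAL⟩
    have hAL := Subgroup.sup_eq_top_of_index_prime (hL ▸ hA) hAL
    have hLt : L ≠ ⊤ := fun h => hA.ne_one (by rw [← hL, h, Subgroup.index_top])
    have : y ∈ L ⊔ A := by rw [sup_comm, hAL]; trivial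
    rw [← SetLike.mem_coe, Subgroup.mul_normal] at this
    obtain ⟨l, hl, a, ha, rfl⟩ := this
    have hla : (l : G ⧸ A) = ((l * a : G) : G ⧸ A) := QuotientGroup.eq.2 (by simpa using ha)
    have hcl := Subgroup.closure_pair_eq_of_le hA (hsup l hla) hL hxL hl
    exact ⟨l, ⟨hla, hcl ▸ hLt⟩, hcl⟩

theorem ncard_lifts_generating (hA : (Nat.card A).Prime) {x y : G}
    (hxy : Subgroup.closure {(x : G ⧸ A), (y : G ⧸ A)} = ⊤) :
    {z : G | (z : G ⧸ A) = y ∧ Subgroup.closure {x, z} = ⊤}.ncard =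
      Nat.card A - (A.complementsThrough x).ncard := by
  rw [← ncard_coset y, ← ncard_lifts_not_generating hA hxy, ← Set.ncard_sdiff (fun z hz => hz.1)]
  congr 1; ext z; simp only [Set.mem_ofPred_eq, Set.mem_sdiff]; tauto

/-- The number of lifts `z` of `y` generating the group with `x` is the same for all `y` generating
the quotient with `x`. -/
theorem genCount_eq_mul (hA : (Nat.card A).Prime) (x : G) :
    genCount x = genCount (x : G ⧸ A) * (Nat.card A - (A.complementsThrough x).ncard) := by
  classical
  let f : {y : G // Subgroup.closure {x, y} = ⊤} →
      {y : G ⧸ A // Subgroup.closure {(x : G ⧸ A), y} = ⊤} := fun y =>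
    ⟨y.1, Subgroup.closure_pair_map_eq_top (QuotientGroup.mk'_surjective A) y.2⟩
  have := Fintype.ofFinite {y : G ⧸ A // Subgroup.closure {(x : G ⧸ A), y} = ⊤}
  have key : ∀ b, Nat.card {a // f a = b} =
      Nat.card A - (A.complementsThrough x).ncard := by
    rintro ⟨b, hb⟩
    obtain ⟨y, rfl⟩ := QuotientGroup.mk_surjective b
    rw [← ncard_lifts_generating hA hb, ← Nat.card_coe_set_eq]
    exact Nat.card_congr
      { toFun := fun a => ⟨a.1.1, congrArg Subtype.val a.2, a.1.2⟩
        invFun := fun z => ⟨⟨z.1, z.2.2⟩, Subtype.ext z.2.1⟩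
        left_inv := fun _ => rfl
        right_inv := fun _ => rfl }
  rw [genCount, ← Nat.card_congr (Equiv.sigmaFiberEquiv f), Nat.card_sigma]
  simp only [key, Finset.sum_const, Finset.card_univ, smul_eq_mul, genCount,
    Nat.card_eq_fintype_card]

/-- Subgroups of index `p` through `x` that contain `A` come from the quotient; the other ones are
complements of `A`, and can only exist if `p` is the order of `A`. -/
theorem ncard_indexThrough (x : G) (p : ℕ) :
    (indexThrough p x).ncard = (indexThrough p (x : G ⧸ A)).ncard +
      {M | M.index = p ∧ x ∈ M ∧ ¬ A ≤ M}.ncard := by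
  have h : (indexThrough p (x : G ⧸ A)).ncard = {M | M.index = p ∧ x ∈ M ∧ A ≤ M}.ncard := by
    refine Set.ncard_congr (fun M _ => M.comap (QuotientGroup.mk' A)) ?_ ?_ ?_
    · rintro M ⟨hM, hx⟩
      exact ⟨(M.index_comap_of_surjective (QuotientGroup.mk'_surjective A)).trans hM, hx,
        QuotientGroup.le_comap_mk' A M⟩
    · intro M N _ _ h
      exact Subgroup.comap_injective (QuotientGroup.mk'_surjective A) h
    · rintro M ⟨hM, hx, hAM⟩
      exact ⟨M.map (QuotientGroup.mk' A), ⟨(Subgroup.index_map_mk' hAM).trans hM, ⟨x, hx, rfl⟩⟩,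
        Subgroup.comap_map_mk' hAM⟩
  rw [h, ← Set.ncard_union_eq]
  · congr 1; ext M; simp only [indexThrough, Set.mem_ofPred_eq, Set.mem_union]; tauto
  · exact Set.disjoint_left.2 fun M h h' => h'.2.2 h.2.2

/-- `HasPrimeSeries G` says that `G` is trivial or has a normal subgroup of prime order the quotient
by which is again of this kind. It is a form of supersolubility for finite groups suited to
induction. -/
inductive HasPrimeSeries.{u} : ∀ (G : Type u) [Group G], Prop
  | of_subsingleton (G : Type u) [Group G] [Subsingleton G] : HasPrimeSeries G
  | of_quotient (G : Type u) [Group G] (A : Subgroup G) [A.Normal] (hA : (Nat.card A).Prime)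
      (h : HasPrimeSeries (G ⧸ A)) : HasPrimeSeries G

theorem HasPrimeSeries.finite {G : Type*} [Group G] (h : HasPrimeSeries G) : Finite G := by
  induction h with
  | of_subsingleton G => infer_instance
  | of_quotient G A hA h ih =>
    apply Nat.finite_of_card_ne_zero
    rw [A.card_eq_card_quotient_mul_card_subgroup]
    exact mul_ne_zero Nat.card_pos.ne' hA.ne_zero

/-- The number of partners of `x` in generating pairs is determined by the numbers of subgroups of
prime index through `x`. In an induction step a complement of `A` through `x` costs the factor
`1 - 1 / |A|` and adds one subgroup of index `|A|` through `x`. The bound `B` only serves to have a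
finite product; primes that do not divide the order contribute `1`. -/
theorem HasPrimeSeries.genCount_eq {G : Type*} [Group G] (h : HasPrimeSeries G) {x y : G}
    (hxy : Subgroup.closure {x, y} = ⊤) {B : ℕ} (hB : Nat.card G ≤ B) :
    (genCount x : ℚ) = Nat.card G *
      ∏ p ∈ (Finset.range (B + 1)).filter Nat.Prime,
        (1 - 1 / (p : ℚ)) ^ (indexThrough p x).ncard := by
  induction h with
  | of_subsingleton G =>
    have h1 : genCount x = 1 := by
      rw [genCount, Nat.card_eq_one_iff_unique]
      exact ⟨inferInstance, ⟨⟨x, Subsingleton.elim _ _⟩⟩⟩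
    rw [h1, Finset.prod_eq_one]
    · simp
    · intro p hp
      have : indexThrough p x = ∅ := by
        ext M
        simp only [indexThrough, Set.mem_ofPred_eq, Set.mem_empty_iff_false, iff_false, not_and]
        intro hM
        rw [Subsingleton.elim M ⊤, Subgroup.index_top] at hM
        exact absurd hM (Finset.mem_filter.1 hp).2.ne_one.symm
      simp [this]
  | of_quotient G A hA h ih =>
    have := h.finite
    have : Finite G := (HasPrimeSeries.of_quotient G A hA h).finite
    have hcard : Nat.card G = Nat.card (G ⧸ A) * Nat.card A :=
      A.card_eq_card_quotient_mul_card_subgroup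
    have hqB : Nat.card (G ⧸ A) ≤ B := by
      refine le_trans ?_ hB
      rw [hcard]; exact Nat.le_mul_of_pos_right _ hA.pos
    have ih := ih (Subgroup.closure_pair_map_eq_top (QuotientGroup.mk'_surjective A) hxy) hqB
    simp only [QuotientGroup.mk'_apply] at ih
    have hc := Set.ncard_le_one_iff_subsingleton.2 (Subgroup.complementsThrough_subsingleton hA hxy)
    have hmem : Nat.card A ∈ (Finset.range (B + 1)).filter Nat.Prime := by
      refine Finset.mem_filter.2 ⟨Finset.mem_range_succ_iff.2 (le_trans ?_ hB), hA⟩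
      rw [hcard]; exact Nat.le_mul_of_pos_left _ Nat.card_pos
    have hfac : ∀ p ∈ (Finset.range (B + 1)).filter Nat.Prime,
        (1 - 1 / (p : ℚ)) ^ (indexThrough p x).ncard =
        (1 - 1 / (p : ℚ)) ^ (indexThrough p (x : G ⧸ A)).ncard *
          if p = Nat.card A then (1 - 1 / (p : ℚ)) ^ (A.complementsThrough x).ncard else 1 := by
      intro p hp
      rw [ncard_indexThrough (A := A), pow_add]
      split_ifs with hpA
      · subst hpA; rfl
      · have : {M : Subgroup G | M.index = p ∧ x ∈ M ∧ ¬ A ≤ M} = ∅ := by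
          ext M
          simp only [Set.mem_ofPred_eq, Set.mem_empty_iff_false, iff_false]
          rintro ⟨hM, -, hAM⟩
          have hp' := (Finset.mem_filter.1 hp).2
          refine hpA (hM ▸ Subgroup.index_eq_card_of_sup_eq_top hA
            (Subgroup.sup_eq_top_of_index_prime (hM ▸ hp') hAM) ?_)
          rintro rfl
          exact hp'.ne_one (by rw [← hM, Subgroup.index_top])
        rw [this]; simp
    rw [Finset.prod_congr rfl hfac, Finset.prod_mul_distrib, Finset.prod_ite_eq' _ _ _, if_pos hmem,
      genCount_eq_mul hA, hcard, Nat.cast_mul, ih]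
    have hA0 : (Nat.card A : ℚ) ≠ 0 := by exact_mod_cast hA.ne_zero
    have : ((Nat.card A - (A.complementsThrough x).ncard : ℕ) : ℚ) =
        Nat.card A * (1 - 1 / (Nat.card A : ℚ)) ^ (A.complementsThrough x).ncard := by
      rw [Nat.cast_sub (hc.trans hA.one_lt.le)]
      rcases Nat.le_one_iff_eq_zero_or_eq_one.1 hc with h0 | h0 <;> rw [h0]
      · simp
      · field_simp; simp
    rw [this]
    push_cast
    ring

/-- The numbers `1 - 1 / p`, for `p` prime, are multiplicatively independent: compare `p`-adic
valuations for the largest prime `p` involved. -/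
theorem eq_of_prod_one_sub_inv_prime_pow_eq (s : Finset ℕ) (hs : ∀ p ∈ s, p.Prime) (e f : ℕ → ℕ)
    (h : ∏ p ∈ s, (1 - 1 / (p : ℚ)) ^ e p = ∏ p ∈ s, (1 - 1 / (p : ℚ)) ^ f p) :
    ∀ p ∈ s, e p = f p := by
  induction s using Finset.induction_on_max with
  | empty => simp
  | insert q s hq ih =>
    have hqs : q ∉ s := fun h => lt_irrefl _ (hq q h)
    have hqp : q.Prime := hs q (Finset.mem_insert_self _ _)
    have hne : ∀ p : ℕ, p.Prime → (1 - 1 / (p : ℚ)) ≠ 0 := by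
      intro p hp
      have : (1 : ℚ) < p := by exact_mod_cast hp.one_lt
      rw [sub_ne_zero, ne_comm, ne_eq, div_eq_one_iff_eq (by positivity)]
      exact this.ne
    have hform : ∀ p : ℕ, p.Prime → (1 - 1 / (p : ℚ)) = ((p - 1 : ℕ) : ℚ) / (p : ℕ) := by
      intro p hp
      have : (p : ℚ) ≠ 0 := by exact_mod_cast hp.ne_zero
      rw [Nat.cast_sub hp.one_lt.le]; field_simp; simp
    have := Fact.mk hqp
    have hval : ∀ g : ℕ → ℕ, padicValRat q (∏ p ∈ insert q s, (1 - 1 / (p : ℚ)) ^ g p) =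
        - (g q : ℤ) := by
      intro g
      have hsm : ∀ m : ℕ, m < q → padicValRat q (m : ℚ) = 0 := by
        intro m hm
        rw [padicValRat.of_nat, Nat.cast_eq_zero]
        rcases Nat.eq_zero_or_pos m with rfl | h0
        · simp
        · exact padicValNat.eq_zero_of_not_dvd (Nat.not_dvd_of_pos_of_lt h0 hm)
      have h0 : ∀ p : ℕ, p.Prime → ((p - 1 : ℕ) : ℚ) ≠ 0 := fun p hp => by
        have := hp.one_lt
        exact_mod_cast (by omega : p - 1 ≠ 0)
      have h0' : ∀ p : ℕ, p.Prime → (p : ℚ) ≠ 0 := fun p hp => by exact_mod_cast hp.ne_zero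
      have hrest : ∀ t : Finset ℕ, (∀ p ∈ t, p.Prime ∧ p < q) →
          padicValRat q (∏ p ∈ t, (1 - 1 / (p : ℚ)) ^ g p) = 0 := by
        intro t
        induction t using Finset.induction_on with
        | empty => simp
        | insert p t hpt ih' =>
          intro ht
          obtain ⟨hpp, hpq⟩ := ht p (by simp)
          have ht' : ∀ r ∈ t, r.Prime ∧ r < q := fun r hr => ht r (Finset.mem_insert_of_mem hr)
          rw [Finset.prod_insert hpt, padicValRat.mul (pow_ne_zero _ (hne p hpp))
            (Finset.prod_ne_zero_iff.2 fun r hr => pow_ne_zero _ (hne r (ht' r hr).1)),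
            ih' ht', padicValRat.pow, hform p hpp, padicValRat.div (h0 p hpp) (h0' p hpp),
            hsm p hpq, hsm (p - 1) (by omega)]
          simp
      rw [Finset.prod_insert hqs, padicValRat.mul (pow_ne_zero _ (hne q hqp))
        (Finset.prod_ne_zero_iff.2 fun r hr => pow_ne_zero _ (hne r (hs r (by simp [hr])))),
        hrest s (fun r hr => ⟨hs r (Finset.mem_insert_of_mem hr), hq r hr⟩), padicValRat.pow,
        hform q hqp, padicValRat.div (h0 q hqp) (h0' q hqp),
        hsm (q - 1) (by have := hqp.pos; omega), padicValRat.of_nat, padicValNat_self]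
      simp
    have heq : e q = f q := by
      have := congrArg (padicValRat q) h
      rw [hval, hval] at this
      omega
    rw [Finset.prod_insert hqs, Finset.prod_insert hqs, heq] at h
    have h' := mul_left_cancel₀ (pow_ne_zero _ (hne q hqp)) h
    intro p hp
    rcases Finset.mem_insert.1 hp with rfl | hp
    · exact heq
    · exact ih (fun r hr => hs r (Finset.mem_insert_of_mem hr)) h' p hp

end Degree

/-! ### Supersoluble and nilpotent groups have prime series -/

theorem IsSupersoluble.of_surjective {G Q : Type*} [Group G] [Group Q] (h : IsSupersoluble G)
    (f : G →* Q) (hf : Function.Surjective f) : IsSupersoluble Q := by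
  obtain ⟨n, N, hN, h0, hn, hc⟩ := h
  have hN' : ∀ i, ((N i).map f).Normal := fun i => (hN i).map f hf
  refine ⟨n, fun i => (N i).map f, hN', by simp [h0],
    by simp [hn, Subgroup.map_top_of_surjective f hf], fun i hi => ?_⟩
  obtain ⟨hle, hcyc⟩ := hc i hi
  refine ⟨Subgroup.map_mono hle, ?_⟩
  let φ := QuotientGroup.map ((N i).subgroupOf (N (i + 1)))
    (((N i).map f).subgroupOf ((N (i + 1)).map f)) (f.subgroupMap (N (i + 1)))
    (fun x hx => ⟨x, hx, rfl⟩)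
  refine isCyclic_of_surjective φ ?_
  intro q
  obtain ⟨y, rfl⟩ := QuotientGroup.mk_surjective q
  obtain ⟨x, rfl⟩ := f.subgroupMap_surjective (N (i + 1)) y
  exact ⟨x, rfl⟩

/-- Conjugation by any element acts on a normal cyclic subgroup by a power map, so preserves its
subgroups. -/
theorem Subgroup.Normal.map_subtype_of_isCyclic {G : Type*} [Group G] {C : Subgroup G}
    (hC : C.Normal) [IsCyclic C] (K : Subgroup C) : (K.map C.subtype).Normal := by
  constructor
  rintro _ ⟨x, hx, rfl⟩ g
  obtain ⟨m, hm⟩ := (MulAut.conjNormal g : MulAut C).toMonoidHom.map_cyclic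
  refine ⟨x ^ m, zpow_mem hx m, ?_⟩
  rw [← hm]
  exact MulAut.conjNormal_apply g x

theorem IsSupersoluble.exists_normal_prime {G : Type*} [Group G] [Finite G] [Nontrivial G]
    (h : IsSupersoluble G) : ∃ A : Subgroup G, A.Normal ∧ (Nat.card A).Prime := by
  classical
  obtain ⟨n, N, hN, h0, hn, hc⟩ := h
  have hex : ∃ i, N i ≠ ⊥ := ⟨n, by rw [hn]; exact top_ne_bot⟩
  obtain ⟨i, hi⟩ : ∃ i, Nat.find hex = i + 1 :=
    Nat.exists_eq_succ_of_ne_zero fun h => Nat.find_spec hex (h ▸ h0)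
  have h1 : N (i + 1) ≠ ⊥ := hi ▸ Nat.find_spec hex
  have h2 : N i = ⊥ := not_not.1 (Nat.find_min hex (by omega))
  have h3 : i < n := by
    have := Nat.find_min' hex (m := n) (by rw [hn]; exact top_ne_bot)
    omega
  have hcyc := (hc i h3).2
  have hcyc' : IsCyclic (N (i + 1)) := by
    have hb : (N i).subgroupOf (N (i + 1)) = ⊥ := by rw [h2, Subgroup.bot_subgroupOf]
    exact isCyclic_of_injective (QuotientGroup.mk' ((N i).subgroupOf (N (i + 1)))) (by
      rw [← MonoidHom.ker_eq_bot_iff, QuotientGroup.ker_mk', hb])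
  have hcard : Nat.card (N (i + 1)) ≠ 1 := fun h => h1 (Subgroup.card_eq_one.1 h)
  have := Fact.mk (Nat.minFac_prime hcard)
  obtain ⟨c, hc⟩ := exists_prime_orderOf_dvd_card' _ (Nat.minFac_dvd (Nat.card (N (i + 1))))
  refine ⟨(Subgroup.zpowers c).map (N (i + 1)).subtype, (hN _).map_subtype_of_isCyclic _, ?_⟩
  rw [Subgroup.card_subtype, Nat.card_zpowers, hc]
  exact Nat.minFac_prime hcard

theorem IsSupersoluble.hasPrimeSeries {G : Type*} [Group G] [hfin : Finite G]
    (h : IsSupersoluble G) : HasPrimeSeries G := by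
  induction hn : Nat.card G using Nat.strong_induction_on generalizing G with
  | _ n ih =>
    rcases subsingleton_or_nontrivial G with hs | hs
    · exact .of_subsingleton G
    · obtain ⟨A, hAn, hA⟩ := h.exists_normal_prime
      refine .of_quotient G A hA (ih _ ?_ (h.of_surjective _ (QuotientGroup.mk'_surjective A)) rfl)
      rw [← hn, A.card_eq_card_quotient_mul_card_subgroup]
      exact lt_mul_of_one_lt_right Nat.card_pos hA.one_lt

theorem Group.IsNilpotent.hasPrimeSeries {G : Type*} [Group G] [hfin : Finite G]
    (h : Group.IsNilpotent G) : HasPrimeSeries G := by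
  induction hn : Nat.card G using Nat.strong_induction_on generalizing G with
  | _ n ih =>
    rcases subsingleton_or_nontrivial G with hs | hs
    · exact .of_subsingleton G
    · have hcard : Nat.card (Subgroup.center G) ≠ 1 := fun h' =>
        Group.IsNilpotent.center_ne_bot (G := G) (Subgroup.card_eq_one.1 h')
      have := Fact.mk (Nat.minFac_prime hcard)
      obtain ⟨c, hc⟩ := exists_prime_orderOf_dvd_card' _
        (Nat.minFac_dvd (Nat.card (Subgroup.center G)))
      let A := Subgroup.zpowers (c : G)
      have hA : (Nat.card A).Prime := by
        rw [Nat.card_zpowers, Subgroup.orderOf_coe, hc]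
        exact Nat.minFac_prime hcard
      have hAc : A ≤ Subgroup.center G := Subgroup.zpowers_le.2 c.2
      have hAn : A.Normal := ⟨fun a ha g => by
        rw [Subgroup.mem_center_iff.1 (hAc ha) g]; simpa using ha⟩
      refine .of_quotient G A hA (ih _ ?_ inferInstance rfl)
      rw [← hn, A.card_eq_card_quotient_mul_card_subgroup]
      exact lt_mul_of_one_lt_right Nat.card_pos hA.one_lt

/-! ### Subgroups of prime index in a group with a prime series -/

theorem HasPrimeSeries.index_prime_of_isCoatom {G : Type*} [Group G] (h : HasPrimeSeries G)
    {M : Subgroup G} (hM : IsCoatom M) : M.index.Prime := by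
  induction h with
  | of_subsingleton G => exact absurd (Subsingleton.elim _ _) hM.1
  | of_quotient G A hA h ih =>
    by_cases hAM : A ≤ M
    · rw [← Subgroup.index_map_mk' hAM]
      refine ih ⟨fun htop => hM.1 ?_, fun K hK => ?_⟩
      · rw [← Subgroup.comap_map_mk' hAM, htop, Subgroup.comap_top]
      · have : K.comap (QuotientGroup.mk' A) = ⊤ := by
          apply hM.2
          rw [← Subgroup.comap_map_mk' hAM]
          exact (Subgroup.comap_lt_comap_of_surjective (QuotientGroup.mk'_surjective A)).2 hK
        rw [← Subgroup.map_comap_eq_self_of_surjective (QuotientGroup.mk'_surjective A) K, this,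
          Subgroup.map_top_of_surjective _ (QuotientGroup.mk'_surjective A)]
    · rw [Subgroup.index_eq_card_of_sup_eq_top hA (hM.2 _ ?_) hM.1]
      · exact hA
      · exact lt_of_le_of_ne le_sup_right fun h => hAM (h ▸ le_sup_left)

theorem HasPrimeSeries.isNilpotent {G : Type*} [Group G] (h : HasPrimeSeries G)
    (hn : ∀ M : Subgroup G, M.index.Prime → M.Normal) : Group.IsNilpotent G := by
  have := h.finite
  exact (Group.isNilpotent_of_finite_tfae.out 0 2 rfl rfl).2
    fun M hM => hn M (h.index_prime_of_isCoatom hM)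

/-- A non-normal subgroup `M` of prime index `p` gives an action of `G` by automorphisms on a chief
factor of order `p` complemented by `M`. Elements acting nontrivially lie in a conjugate of `M`;
elements acting trivially lie in all conjugates of `M` or in none. -/
theorem HasPrimeSeries.exists_hom_units {G : Type*} [Group G] (h : HasPrimeSeries G) {p : ℕ}
    (hp : p.Prime) {M : Subgroup G} (hM : M.index = p) (hMn : ¬ M.Normal) :
    ∃ k : G →* (ZMod p)ˣ, (∀ x, k x ≠ 1 → ∃ g, g * x * g⁻¹ ∈ M) ∧
      ∀ x, k x = 1 → x ∈ M → ∀ g, g * x * g⁻¹ ∈ M := by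
  induction h with
  | of_subsingleton G => exact absurd (Subsingleton.elim ⊤ M ▸ inferInstance) hMn
  | of_quotient G A hA h ih =>
    have hfin : Finite G := (HasPrimeSeries.of_quotient G A hA h).finite
    have hmem : ∀ x, x ∈ (M.map (QuotientGroup.mk' A)).comap (QuotientGroup.mk' A) ↔
      QuotientGroup.mk' A x ∈ M.map (QuotientGroup.mk' A) := fun x => Iff.rfl
    by_cases hAM : A ≤ M
    · obtain ⟨k, hk1, hk2⟩ := ih (M := M.map (QuotientGroup.mk' A))
        ((Subgroup.index_map_mk' hAM).trans hM) (fun hn => hMn (by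
          rw [← Subgroup.comap_map_mk' hAM]; exact hn.comap _))
      refine ⟨k.comp (QuotientGroup.mk' A), fun x hx => ?_, fun x hx hxM g => ?_⟩
      · obtain ⟨g, hg⟩ := hk1 _ hx
        obtain ⟨g, rfl⟩ := QuotientGroup.mk'_surjective A g
        rw [← map_inv, ← map_mul, ← map_mul, ← hmem, Subgroup.comap_map_mk' hAM] at hg
        exact ⟨g, hg⟩
      · have := hk2 _ hx ⟨x, hxM, rfl⟩ (QuotientGroup.mk' A g)
        rwa [← map_inv, ← map_mul, ← map_mul, ← hmem, Subgroup.comap_map_mk' hAM] at this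
    · have hsup := Subgroup.sup_eq_top_of_index_prime (hM ▸ hp) hAM
      have hMt : M ≠ ⊤ := fun h => hMn (h ▸ inferInstance)
      obtain rfl : Nat.card A = p := hM ▸ (Subgroup.index_eq_card_of_sup_eq_top hA hsup hMt).symm
      have := Fact.mk hA
      have hcyc : IsCyclic A := isCyclic_of_prime_card rfl
      let k : G →* (ZMod (Nat.card A))ˣ :=
        (IsCyclic.mulAutMulEquiv A).toMonoidHom.comp MulAut.conjNormal
      have hk : ∀ x, k x = 1 ↔ ∀ a ∈ A, x * a * x⁻¹ = a := by
        intro x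
        have : k x = 1 ↔ (MulAut.conjNormal x : MulAut A) = 1 :=
          (IsCyclic.mulAutMulEquiv A).map_eq_one_iff
        rw [this, MulEquiv.ext_iff]
        simp only [Subtype.forall, Subtype.ext_iff, MulAut.conjNormal_apply, MulAut.one_apply]
      refine ⟨k, fun x hx => ?_, fun x hx hxM g => ?_⟩
      · -- `b ↦ ⁅b, x⁆` is injective on `A`, since `x` centralizes no nontrivial element of `A`
        let f : A → A := fun b => ⟨b * (x * (b : G)⁻¹ * x⁻¹),
          mul_mem b.2 (Subgroup.Normal.conj_mem inferInstance _ (inv_mem b.2) x)⟩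
        have hf : Function.Injective f := by
          intro b c hbc
          have hbc : (b : G) * (x * (b : G)⁻¹ * x⁻¹) = c * (x * (c : G)⁻¹ * x⁻¹) :=
            congrArg Subtype.val hbc
          have hcb : (c : G)⁻¹ * b ∈ Subgroup.centralizer {x} := by
            rw [Subgroup.mem_centralizer_singleton_iff]
            symm
            calc x * ((c : G)⁻¹ * b) = (c : G)⁻¹ * (c * (x * (c : G)⁻¹ * x⁻¹)) * x * b := by group
              _ = (c : G)⁻¹ * b * x := by rw [← hbc]; group
          rcases ((Subgroup.centralizer {x}).subgroupOf A).eq_bot_or_eq_top_of_prime_card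
            with h | h
          · have : c⁻¹ * b ∈ (Subgroup.centralizer {x}).subgroupOf A := hcb
            rw [h, Subgroup.mem_bot, inv_mul_eq_one] at this
            exact this.symm
          · exfalso
            refine hx ((hk x).2 fun a ha => ?_)
            have := Subgroup.subgroupOf_eq_top.1 h ha
            rw [Subgroup.mem_centralizer_singleton_iff] at this
            rw [← this]; group
        have hxs : x ∈ A ⊔ M := hsup ▸ Subgroup.mem_top x
        rw [← SetLike.mem_coe, Subgroup.normal_mul] at hxs
        obtain ⟨a, ha, m, hm, hxam⟩ := hxs
        obtain ⟨b, hb⟩ := Finite.surjective_of_injective hf ⟨a⁻¹, inv_mem ha⟩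
        have hb : (b : G) * (x * (b : G)⁻¹ * x⁻¹) = a⁻¹ := congrArg Subtype.val hb
        refine ⟨b, ?_⟩
        have : (b : G) * x * (b : G)⁻¹ = m := by
          calc (b : G) * x * (b : G)⁻¹ = (b : G) * (x * (b : G)⁻¹ * x⁻¹) * x := by group
            _ = m := by rw [hb, ← hxam]; group
        rwa [this]
      · have hg : g ∈ M ⊔ A := by rw [sup_comm, hsup]; trivial
        rw [← SetLike.mem_coe, Subgroup.mul_normal] at hg
        obtain ⟨m, hm, a, ha, rfl⟩ := hg
        have h1 := (hk x).1 hx a ha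
        have : m * a * x * (m * a)⁻¹ = m * x * m⁻¹ := by
          rw [mul_inv_eq_iff_eq_mul] at h1
          have h2 : a * x * a⁻¹ = x := by rw [← h1]; group
          calc m * a * x * (m * a)⁻¹ = m * (a * x * a⁻¹) * m⁻¹ := by group
            _ = _ := by rw [h2]
        show m * a * x * (m * a)⁻¹ ∈ M
        rw [this]
        exact mul_mem (mul_mem hm hxM) (inv_mem hm)

/-! ### Normal subgroups of prime index -/

section NormalIndex

theorem Subgroup.Normal.exists_hom_zmod {G : Type*} [Group G] {p : ℕ} (hp : p.Prime)
    {L : Subgroup G} (hL : L.Normal) (hLp : L.index = p) :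
    ∃ φ : G →* Multiplicative (ZMod p), φ.ker = L := by
  have := Fact.mk hp
  let e : G ⧸ L ≃* Multiplicative (ZMod p) := mulEquivOfPrimeCardEq (p := p)
    (by rw [← Subgroup.index_eq_card, hLp]) (by simp)
  refine ⟨e.toMonoidHom.comp (QuotientGroup.mk' L), ?_⟩
  ext x
  simp

/-- A linear combination of homomorphisms to `ZMod p` with kernels `L` and `L'` kills `z`. -/
theorem Subgroup.exists_normal_index_prime_mem {G : Type*} [Group G] [Finite G] {p : ℕ}
    (hp : p.Prime) {L L' : Subgroup G} (hL : L.Normal) (hL' : L'.Normal) (hLp : L.index = p)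
    (hLp' : L'.index = p) (hne : L ≠ L') (z : G) :
    ∃ N : Subgroup G, N.Normal ∧ N.index = p ∧ z ∈ N ∧ L ⊓ L' ≤ N := by
  have := Fact.mk hp
  by_cases hz : z ∈ L
  · exact ⟨L, hL, hLp, hz, inf_le_left⟩
  obtain ⟨φ, rfl⟩ := hL.exists_hom_zmod hp hLp
  obtain ⟨φ', rfl⟩ := hL'.exists_hom_zmod hp hLp'
  have hz0 : (φ z).toAdd ≠ 0 := fun h => hz h
  let n : ℕ := (-((φ' z).toAdd / (φ z).toAdd)).val
  let ψ : G →* Multiplicative (ZMod p) := φ' * φ ^ n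
  have hψ : ∀ x, ψ x = φ' x * φ x ^ n := fun x => rfl
  refine ⟨ψ.ker, inferInstance, ?_, ?_, ?_⟩
  · rw [Subgroup.index_ker]
    have hc : Nat.card (Multiplicative (ZMod p)) = p := by simp
    have : Fact (Nat.card (Multiplicative (ZMod p))).Prime := ⟨hc.symm ▸ hp⟩
    rcases ψ.range.eq_bot_or_eq_top_of_prime_card with h | h
    · refine absurd (Subgroup.eq_of_le_of_index_eq (fun x hx => ?_) (hLp.trans hLp'.symm)) hne
      have h1 : ψ x ∈ ψ.range := ⟨x, rfl⟩
      rw [h, Subgroup.mem_bot, hψ, MonoidHom.mem_ker.1 hx, one_pow, mul_one] at h1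
      exact h1
    · rw [h, Subgroup.card_top, hc]
  · rw [MonoidHom.mem_ker, hψ]
    apply Multiplicative.toAdd.injective
    rw [toAdd_mul, toAdd_pow, toAdd_one, nsmul_eq_mul, ZMod.natCast_zmod_val]
    field_simp
    ring
  · rintro x ⟨hx, hx'⟩
    rw [MonoidHom.mem_ker, hψ, MonoidHom.mem_ker.1 hx, MonoidHom.mem_ker.1 hx', one_pow, one_mul]

variable {G : Type*} [Group G] [Finite G] {p : ℕ}

/-- Two normal subgroups of index `p` through `x` would yield one through `x` and `y`. -/
theorem indexThrough_subsingleton_of_normal (hp : p.Prime)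
    (hn : ∀ M : Subgroup G, M.index = p → M.Normal) {x y : G}
    (hxy : Subgroup.closure {x, y} = ⊤) : (indexThrough p x).Subsingleton := by
  rintro L ⟨hL, hxL⟩ L' ⟨hL', hxL'⟩
  by_contra hne
  obtain ⟨N, -, hN, hyN, hle⟩ :=
    Subgroup.exists_normal_index_prime_mem hp (hn L hL) (hn L' hL') hL hL' hne y
  have := Subgroup.closure_pair_le (hle ⟨hxL, hxL'⟩) hyN
  rw [hxy, top_le_iff] at this
  rw [this, Subgroup.index_top] at hN
  exact hp.ne_one hN.symm

/-- Subgroups of index `p` through `x` and through `y` are distinct if `x` and `y` generate the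
group, so if they are normal, there is one through every element. -/
theorem indexThrough_nonempty_of_normal (hp : p.Prime)
    (hn : ∀ M : Subgroup G, M.index = p → M.Normal) {x y : G}
    (hxy : Subgroup.closure {x, y} = ⊤) (hx : (indexThrough p x).Nonempty)
    (hy : (indexThrough p y).Nonempty) (z : G) : (indexThrough p z).Nonempty := by
  obtain ⟨L, hL, hxL⟩ := hx
  obtain ⟨L', hL', hyL'⟩ := hy
  have hne : L ≠ L' := by
    rintro rfl
    have := Subgroup.closure_pair_le hxL hyL'
    rw [hxy, top_le_iff] at this
    rw [this, Subgroup.index_top] at hL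
    exact hp.ne_one hL.symm
  obtain ⟨N, -, hN, hzN, -⟩ :=
    Subgroup.exists_normal_index_prime_mem hp (hn L hL) (hn L' hL') hL hL' hne z
  exact ⟨N, hN, hzN⟩

end NormalIndex

/-! ### Normality from the incidence of generating pairs and subgroups of prime index -/

section Incidence

theorem Subgroup.closure_pair_eq_top_of_mem {G : Type*} [Group G] {x y x' y' : G}
    (h : Subgroup.closure {x, y} = ⊤) (hx : x ∈ Subgroup.closure {x', y'})
    (hy : y ∈ Subgroup.closure {x', y'}) : Subgroup.closure {x', y'} = ⊤ := by
  rw [← top_le_iff, ← h]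
  exact Subgroup.closure_pair_le hx hy

/-- The Euclidean algorithm on the exponents of the images of a generating pair in a cyclic group
produces a generating pair whose first member has trivial image. -/
theorem exists_generating_pair_map_eq_one {G C : Type*} [Group G] [Group C] [Finite C]
    [IsCyclic C] (k : G →* C) {x y : G} (hxy : Subgroup.closure {x, y} = ⊤) :
    ∃ x y : G, Subgroup.closure {x, y} = ⊤ ∧ k x = 1 := by
  obtain ⟨g, hg⟩ := IsCyclic.exists_monoid_generator (α := C)
  obtain ⟨a, ha⟩ := hg (k x)
  obtain ⟨b, hb⟩ := hg (k y)
  simp only at ha hb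
  induction hn : a + b using Nat.strong_induction_on generalizing a b x y with
  | _ n ih =>
    have hmx : ∀ u v : G, u ∈ Subgroup.closure {u, v} :=
      fun u v => Subgroup.subset_closure (by simp)
    have hmy : ∀ u v : G, v ∈ Subgroup.closure {u, v} :=
      fun u v => Subgroup.subset_closure (by simp)
    rcases Nat.eq_zero_or_pos a with rfl | ha0
    · exact ⟨x, y, hxy, by rw [← ha, pow_zero]⟩
    rcases Nat.eq_zero_or_pos b with rfl | hb0
    · exact ⟨y, x, by rwa [Set.pair_comm], by rw [← hb, pow_zero]⟩
    rcases le_total a b with hab | hab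
    · refine ih (a + (b - a)) (by omega) (x := x) (y := x⁻¹ * y)
        (Subgroup.closure_pair_eq_top_of_mem hxy (hmx _ _) ?_) a ha (b - a) ?_ rfl
      · simpa using mul_mem (hmx x (x⁻¹ * y)) (hmy x (x⁻¹ * y))
      · rw [map_mul, map_inv, ← ha, ← hb, eq_inv_mul_iff_mul_eq, ← pow_add]
        congr 1; omega
    · refine ih ((a - b) + b) (by omega) (x := y⁻¹ * x) (y := y)
        (Subgroup.closure_pair_eq_top_of_mem hxy ?_ (hmy _ _)) (a - b) ?_ b hb rfl
      · simpa using mul_mem (hmy (y⁻¹ * x) y) (hmx (y⁻¹ * x) y)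
      · rw [map_mul, map_inv, ← ha, ← hb, eq_inv_mul_iff_mul_eq, ← pow_add]
        congr 1; omega

variable {G : Type*} [Group G] {p : ℕ}

theorem comap_conj_mem_indexThrough {M : Subgroup G} (hM : M.index = p) {x g : G}
    (h : g * x * g⁻¹ ∈ M) : M.comap (MulAut.conj g).toMonoidHom ∈ indexThrough p x :=
  ⟨(M.index_comap_of_surjective (MulAut.conj g).surjective).trans hM, h⟩

/-- If all conjugates of `M` contain `x`, and `x` lies in a single subgroup of index `p`, then the
conjugates of `M` coincide. -/
theorem normal_of_forall_conj_mem {M : Subgroup G} (hM : M.index = p) {x : G}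
    (hx : (indexThrough p x).Subsingleton) (h : ∀ g, g * x * g⁻¹ ∈ M) : M.Normal := by
  refine ⟨fun m hm g => ?_⟩
  have h1 : M ∈ indexThrough p x := ⟨hM, by simpa using h 1⟩
  have h2 := hx h1 (comap_conj_mem_indexThrough hM (h g))
  rw [h2] at hm
  exact hm

/-- If each member of a generating pair lies in at most one subgroup of index `p`, and if the
existence of a generating pair both of whose members lie in subgroups of index `p` forces every
member of a generating pair to do so, then all subgroups of index `p` are normal. -/
theorem HasPrimeSeries.normal_of_index_eq_prime [Finite G] (h : HasPrimeSeries G) (hp : p.Prime)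
    {x₀ y₀ : G} (hgen : Subgroup.closure {x₀, y₀} = ⊤)
    (hsub : ∀ x y : G, Subgroup.closure {x, y} = ⊤ → (indexThrough p x).Subsingleton)
    (hne : ∀ x y : G, Subgroup.closure {x, y} = ⊤ → (indexThrough p x).Nonempty →
      (indexThrough p y).Nonempty → ∀ z w : G, Subgroup.closure {z, w} = ⊤ →
      (indexThrough p z).Nonempty)
    (M : Subgroup G) (hM : M.index = p) : M.Normal := by
  by_contra hMn
  have := Fact.mk hp
  obtain ⟨k, hk1, hk2⟩ := h.exists_hom_units hp hM hMn
  have hmx : ∀ u v : G, u ∈ Subgroup.closure {u, v} :=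
    fun u v => Subgroup.subset_closure (by simp)
  have hmy : ∀ u v : G, v ∈ Subgroup.closure {u, v} :=
    fun u v => Subgroup.subset_closure (by simp)
  have hmul : ∀ x y : G, Subgroup.closure {x, y} = ⊤ → Subgroup.closure {x * y, x} = ⊤ := by
    intro x y hxy
    refine Subgroup.closure_pair_eq_top_of_mem hxy (hmy _ _) ?_
    simpa using mul_mem (inv_mem (hmy (x * y) x)) (hmx (x * y) x)
  have hmul' : ∀ x y : G, Subgroup.closure {x, y} = ⊤ → Subgroup.closure {x * y, y} = ⊤ := by
    intro x y hxy
    refine Subgroup.closure_pair_eq_top_of_mem hxy ?_ (hmy _ _)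
    simpa using mul_mem (hmx (x * y) y) (inv_mem (hmy (x * y) y))
  have hky : ∀ x y : G, Subgroup.closure {x, y} = ⊤ → k x = 1 → k y ≠ 1 := by
    intro x y hxy hx hy
    have hker : Subgroup.closure {x, y} ≤ k.ker := Subgroup.closure_pair_le hx hy
    rw [hxy] at hker
    exact hMn ⟨fun m hm g => hk2 m (hker (Subgroup.mem_top m)) hm g⟩
  obtain ⟨x, y, hxy, hx⟩ := exists_generating_pair_map_eq_one k hgen
  have hthrough : ∀ z, k z ≠ 1 → (indexThrough p z).Nonempty := fun z hz => by
    obtain ⟨g, hg⟩ := hk1 z hz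
    exact ⟨_, comap_conj_mem_indexThrough hM hg⟩
  have hall : ∀ z w : G, Subgroup.closure {z, w} = ⊤ → (indexThrough p z).Nonempty :=
    hne _ _ (hmul' x y hxy) (hthrough _ (by rw [map_mul, hx, one_mul]; exact hky x y hxy hx))
      (hthrough y (hky x y hxy hx))
  -- the subgroup of index `p` through `x` is normal if `k x = 1`
  have hnormal : ∀ x y : G, Subgroup.closure {x, y} = ⊤ → k x = 1 →
      ∃ L : Subgroup G, L.Normal ∧ L.index = p ∧ x ∈ L := by
    intro x y hxy hx
    obtain ⟨L, hL, hxL⟩ := hall x y hxy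
    refine ⟨L, ?_, hL, hxL⟩
    by_contra hLn
    obtain ⟨k', hk1', hk2'⟩ := h.exists_hom_units hp hL hLn
    have hx' : k' x ≠ 1 := fun h =>
      hLn (normal_of_forall_conj_mem hL (hsub x y hxy) (hk2' x h hxL))
    have hy := hky x y hxy hx
    obtain ⟨z, hz, hkz, hkz'⟩ : ∃ z, Subgroup.closure {z, x} = ⊤ ∧ k z ≠ 1 ∧ k' z ≠ 1 := by
      by_cases hy' : k' y = 1
      · refine ⟨x * y, hmul x y hxy, ?_, ?_⟩
        · rwa [map_mul, hx, one_mul]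
        · rwa [map_mul, hy', mul_one]
      · exact ⟨y, by rwa [Set.pair_comm], hy, hy'⟩
    -- so a conjugate of `M` and a conjugate of `L` coincide, and `x` lies in a conjugate of `M`
    obtain ⟨g, hg⟩ := hk1 z hkz
    obtain ⟨g', hg'⟩ := hk1' z hkz'
    have heq := hsub z x hz (comap_conj_mem_indexThrough hM hg)
      (comap_conj_mem_indexThrough hL hg')
    have hxm : g'⁻¹ * x * g' ∈ L.comap (MulAut.conj g').toMonoidHom := by
      show g' * (g'⁻¹ * x * g') * g'⁻¹ ∈ L
      convert hxL using 1; group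
    rw [← heq] at hxm
    have hxm : g * (g'⁻¹ * x * g') * g⁻¹ ∈ M := hxm
    refine hMn (normal_of_forall_conj_mem hM (hsub x y hxy) fun c => ?_)
    have := hk2 _ (by simp [hx]) hxm (c * g' * g⁻¹)
    convert this using 1; group
  obtain ⟨L, hLn, hL, hxL⟩ := hnormal x y hxy hx
  -- `p - 1` is a multiple of the order of `k y` and prime to `p`
  obtain ⟨L', hLn', hL', hxL'⟩ := hnormal (x * y ^ (p - 1)) y
    (Subgroup.closure_pair_eq_top_of_mem hxy (by
      simpa using mul_mem (hmx (x * y ^ (p - 1)) y)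
        (inv_mem (pow_mem (hmy (x * y ^ (p - 1)) y) (p - 1)))) (hmy _ _))
    (by rw [map_mul, hx, map_pow, ZMod.units_pow_card_sub_one_eq_one, mul_one])
  -- `y ^ p` lies in every normal subgroup of index `p`, so `L = L'` would contain `x` and `y`
  by_cases hLL : L = L'
  · subst hLL
    have h1 : y ^ (p - 1) ∈ L := by simpa using mul_mem (inv_mem hxL) hxL'
    have h2 : y ^ p ∈ L := hL ▸ L.pow_index_mem y
    have h3 : y ∈ L := by
      have h4 : y ^ p = y ^ (p - 1) * y := by rw [← pow_succ, Nat.sub_add_cancel hp.pos]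
      rw [h4] at h2
      simpa using mul_mem (inv_mem h1) h2
    have := Subgroup.closure_pair_le hxL h3
    rw [hxy, top_le_iff] at this
    rw [this, Subgroup.index_top] at hL
    exact hp.ne_one hL.symm
  · -- `y` would lie in a normal subgroup of index `p` and in a conjugate of `M`
    obtain ⟨N, hNn, hN, hyN, -⟩ :=
      Subgroup.exists_normal_index_prime_mem hp hLn hLn' hL hL' hLL y
    obtain ⟨g, hg⟩ := hk1 y (hky x y hxy hx)
    have heq := hsub y x (by rwa [Set.pair_comm]) ⟨hN, hyN⟩ (comap_conj_mem_indexThrough hM hg)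
    refine hMn (normal_of_forall_conj_mem hM (x := g * y * g⁻¹) ?_ fun c => ?_)
    · exact hsub _ (g * x * g⁻¹) (Subgroup.closure_pair_map_eq_top
        (f := (MulAut.conj g).toMonoidHom) (MulAut.conj g).surjective (by rwa [Set.pair_comm]))
    · have := hNn.conj_mem y hyN (g⁻¹ * c * g)
      rw [heq] at this
      have : g * (g⁻¹ * c * g * y * (g⁻¹ * c * g)⁻¹) * g⁻¹ ∈ M := this
      convert this using 1; group

end Incidence

/-! ### Reading off the incidence from the generating graph -/

theorem isCyclic_of_closure_pair_self {G : Type*} [Group G] {x : G}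
    (h : Subgroup.closure {x, x} = ⊤) : IsCyclic G := by
  rw [Set.pair_eq_singleton, ← Subgroup.zpowers_eq_closure] at h
  exact ⟨x, fun y => Subgroup.mem_zpowers_iff.1 (h.symm ▸ Subgroup.mem_top y)⟩

/-- A vertex adjacent to all others in the generating graph makes the group cyclic. -/
theorem isCyclic_of_forall_adj {G : Type*} [Group G] {x : G}
    (h : ∀ y, y ≠ x → (generatingGraph G).Adj x y) : IsCyclic G := by
  have key : ∀ z : G, Subgroup.closure {z, 1} = ⊤ → IsCyclic G := by
    intro z hz
    apply isCyclic_of_closure_pair_self (x := z)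
    rw [← top_le_iff, ← hz]
    exact Subgroup.closure_pair_le (Subgroup.subset_closure (by simp)) (one_mem _)
  by_cases hx : x = 1
  · subst hx
    by_cases hs : ∃ y : G, y ≠ 1
    · obtain ⟨y, hy⟩ := hs
      exact key y (by rw [Set.pair_comm]; exact (h y hy).2)
    · push Not at hs
      exact ⟨1, fun y => ⟨0, by simp [hs y]⟩⟩
  · exact key x (h 1 (Ne.symm hx)).2

theorem IsCyclic.forall_adj {G : Type*} [Group G] [hc : IsCyclic G] :
    ∃ x : G, ∀ y, y ≠ x → (generatingGraph G).Adj x y := by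
  obtain ⟨x, hx⟩ := hc.exists_generator
  refine ⟨x, fun y hy => ⟨hy.symm, ?_⟩⟩
  rw [eq_top_iff]
  exact fun z _ => Subgroup.zpowers_le.2 (Subgroup.subset_closure (by simp)) (hx z)

theorem isCyclic_of_iso {G H : Type*} [Group G] [Group H] [IsCyclic G]
    (e : generatingGraph G ≃g generatingGraph H) : IsCyclic H := by
  obtain ⟨x, hx⟩ := IsCyclic.forall_adj (G := G)
  refine isCyclic_of_forall_adj (x := e x) fun y hy => ?_
  obtain ⟨y, rfl⟩ := e.surjective y
  exact e.map_rel_iff.2 (hx y fun h => hy (h ▸ rfl))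

theorem adj_iff_of_not_isCyclic {G : Type*} [Group G] (hG : ¬ IsCyclic G) {x y : G} :
    (generatingGraph G).Adj x y ↔ Subgroup.closure {x, y} = ⊤ :=
  ⟨fun h => h.2, fun h => ⟨fun hxy => hG (isCyclic_of_closure_pair_self (x := x)
    (by rw [← hxy] at h; exact h)), h⟩⟩

/-- For noncyclic groups with prime series, an isomorphism of generating graphs preserves the number
of subgroups of index `p` through the members of generating pairs. -/
theorem ncard_indexThrough_eq_of_iso {G H : Type*} [Group G] [Group H] (hG : HasPrimeSeries G)
    (hH : HasPrimeSeries H) (hGc : ¬ IsCyclic G) (hHc : ¬ IsCyclic H)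
    (e : generatingGraph G ≃g generatingGraph H) {p : ℕ} (hp : p.Prime) {x y : G}
    (hxy : Subgroup.closure {x, y} = ⊤) :
    (indexThrough p x).ncard = (indexThrough p (e x)).ncard := by
  have hfG := hG.finite
  have hfH := hH.finite
  have hcard : Nat.card G = Nat.card H := Nat.card_congr e.toEquiv
  have hcl : ∀ z : G, Subgroup.closure {x, z} = ⊤ ↔ Subgroup.closure {e x, e z} = ⊤ := fun z => by
    rw [← adj_iff_of_not_isCyclic hGc, ← adj_iff_of_not_isCyclic hHc, e.map_adj_iff]
  have hcount : genCount x = genCount (e x) := Nat.card_congr (e.toEquiv.subtypeEquiv hcl)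
  let B := max p (Nat.card G)
  have h1 := hG.genCount_eq hxy (B := B) (le_max_right _ _)
  have h2 := hH.genCount_eq ((hcl y).1 hxy) (B := B) (hcard ▸ le_max_right _ _)
  rw [hcount, h2, ← hcard] at h1
  have h0 : (Nat.card G : ℚ) ≠ 0 := by exact_mod_cast Nat.card_pos.ne'
  exact (eq_of_prod_one_sub_inv_prime_pow_eq _ (fun q hq => (Finset.mem_filter.1 hq).2) _ _
    (mul_left_cancel₀ h0 h1) p
    (Finset.mem_filter.2 ⟨Finset.mem_range_succ_iff.2 (le_max_left _ _), hp⟩)).symm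

/-! ### Nilpotency is visible in the generating graph -/

theorem theorem4p1 {G H : Type*} [Group G] [Finite G] [Group H] [Finite H]
    (hG₂ : IsTwoGenerated G) (hH₂ : IsTwoGenerated H)
    (hiso : Nonempty (generatingGraph G ≃g generatingGraph H))
    (hG : Group.IsNilpotent G) (hH : IsSupersoluble H) :
    Group.IsNilpotent H := by
  obtain ⟨e⟩ := hiso
  by_cases hHc : IsCyclic H
  · let _ : CommGroup H := IsCyclic.commGroup
    exact inferInstance
  have hGc : ¬ IsCyclic G := fun h => hHc (isCyclic_of_iso e)
  have hGs := hG.hasPrimeSeries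
  have hHs := hH.hasPrimeSeries
  refine hHs.isNilpotent fun M hM => ?_
  obtain ⟨x₀, y₀, hgen⟩ := hH₂
  have hGn : ∀ M' : Subgroup G, M'.index = M.index → M'.Normal := fun M' hM' => by
    refine (Group.isNilpotent_of_finite_tfae.out 0 2 rfl rfl).1 hG M' ⟨?_, ?_⟩
    · rintro rfl
      rw [Subgroup.index_top] at hM'
      exact hM.ne_one hM'.symm
    · intro K hK
      rw [← sup_eq_left.2 hK.le]
      exact Subgroup.sup_eq_top_of_index_prime (hM' ▸ hM) (not_le_of_gt hK)
  have hcl : ∀ {x y : H}, Subgroup.closure {x, y} = ⊤ →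
      Subgroup.closure {e.symm x, e.symm y} = ⊤ := fun {x y} h => by
    rwa [← adj_iff_of_not_isCyclic hGc, e.symm.map_adj_iff, adj_iff_of_not_isCyclic hHc]
  have hn : ∀ {x y : H}, Subgroup.closure {x, y} = ⊤ →
      (indexThrough M.index (e.symm x)).ncard = (indexThrough M.index x).ncard := fun {x y} h => by
    rw [ncard_indexThrough_eq_of_iso hGs hHs hGc hHc e hM (hcl h), e.apply_symm_apply]
  have hne : ∀ {x y : H}, Subgroup.closure {x, y} = ⊤ →
      ((indexThrough M.index (e.symm x)).Nonempty ↔ (indexThrough M.index x).Nonempty) :=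
    fun {x y} h => by
      rw [← Set.ncard_pos, ← Set.ncard_pos, hn h]
  refine hHs.normal_of_index_eq_prime hM hgen (fun x y h => ?_) (fun x y h hx hy z w hz => ?_) M rfl
  · rw [← Set.ncard_le_one_iff_subsingleton, ← hn h, Set.ncard_le_one_iff_subsingleton]
    exact indexThrough_subsingleton_of_normal hM hGn (hcl h)
  · have h' : Subgroup.closure {y, x} = ⊤ := by rwa [Set.pair_comm]
    have hx' := (hne h).2 hx
    have hy' := (hne h').2 hy
    exact (hne hz).1 (indexThrough_nonempty_of_normal hM hGn (hcl h) hx' hy' (e.symm z))
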